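/- Let $\Omega\subset\mathbb{R}^d$ be a bounded domain (a nonempty, bounded, open and connected set), let $1\le q<\infty$, and let $\Phi$ be a (finite-valued) Young function, i.e. a convex function $\Phi:[0,\infty)\to[0,\infty)$ with $\Phi(0)=0$ and $\Phi(t)\to\infty$ as $t\to\infty$. Let $\Psi(t)=\sup_{s\ge 0}\,(st-\Phi(s))\in[0,\infty]$ be the complementary function, and let $L_\Phi(\Omega)$ be the Orlicz space of all (classes of a.e. equal) measurable functions $u:\Omega\to\mathbb{R}$ with finite Orlicz norm $$\|u\|_{L_\Phi(\Omega)}=\sup\Big\{\int_\Omega |u v|\,dx \;:\; v \text{ measurable},\ \int_\Omega \Psi(|v|)\,dx\le 1\Big\}.$$ Let $W^{1,q}_0(\Omega)$ be the closure of $C_c^\infty(\Omega)$ in $W^{1,q}(\Omega)$, and let $X=W^{1,q}_0(\Omega)\cap L^\infty(\Omega)$ with the norm $\|u\|_X=\max\{\|u\|_{W^{1,q}(\Omega)},\|u\|_{L^\infty(\Omega)}\}$, where $\|u\|_{W^{1,q}(\Omega)}=\|u\|_{L^q(\Omega)}+\|\nabla u\|_{L^q(\Omega)}$. Then $X$ embeds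 compactly into $L_\Phi(\Omega)$: every $u\in X$ belongs to $L_\Phi(\Omega)$, and the inclusion map $X\to L_\Phi(\Omega)$, $u\mapsto u$, is a continuous linear operator that is compact, i.e. it maps bounded subsets of $X$ to relatively compact subsets of $L_\Phi(\Omega)$. -/

import Mathlib

open MeasureTheory TopologicalSpace
open scoped ENNReal NNReal Distributions

noncomputable section

/-! ### Spaces cut out by an extended norm -/

/-- If `S` is a subspace on which the extended norm `N` is finite, then `u ↦ (N u).toReal`
satisfies the axioms of a norm on `S`. -/
theorem normCoreOfENorm {V : Type*} [AddCommGroup V] [Module ℝ V] (S : Submodule ℝ V)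
    (N : V → ℝ≥0∞) [Norm S] (hnorm : ∀ u : S, ‖u‖ = (N u).toReal)
    (hfin : ∀ u ∈ S, N u ≠ ∞)
    (hadd : ∀ u v : V, N (u + v) ≤ N u + N v)
    (hsmul : ∀ (c : ℝ) (u : V), N (c • u) ≤ ‖c‖ₑ * N u)
    (hzero : ∀ u : V, N u = 0 → u = 0) : NormedSpace.Core ℝ S where
  norm_nonneg u := by rw [hnorm]; exact ENNReal.toReal_nonneg
  norm_smul c u := by
    rw [hnorm, hnorm]
    have key : N ((c • u : S) : V) = ‖c‖ₑ * N u := by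
      refine le_antisymm (hsmul c u) ?_
      by_cases hc : c = 0
      · simp [hc]
      · have h1 := hsmul c⁻¹ (c • (u : V))
        rw [smul_smul, inv_mul_cancel₀ hc, one_smul] at h1
        calc ‖c‖ₑ * N u ≤ ‖c‖ₑ * (‖c⁻¹‖ₑ * N (c • (u : V))) := by gcongr
          _ = N (c • (u : V)) := by
            rw [← mul_assoc, ← enorm_mul, mul_inv_cancel₀ hc, enorm_one, one_mul]
    rw [key, ENNReal.toReal_mul, toReal_enorm]
  norm_triangle u v := by
    rw [hnorm, hnorm, hnorm, ← ENNReal.toReal_add (hfin u u.2) (hfin v v.2)]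
    exact ENNReal.toReal_mono (ENNReal.add_ne_top.2 ⟨hfin u u.2, hfin v v.2⟩) (hadd u v)
  norm_eq_zero_iff u := by
    rw [hnorm, ENNReal.toReal_eq_zero_iff, or_iff_left (hfin u u.2)]
    constructor
    · intro h
      exact Subtype.ext (hzero u h)
    · rintro rfl
      have := hsmul 0 (0 : V)
      simpa using this

/-! ### Young functions and Orlicz spaces -/

/-- A (finite-valued) Young function: a convex function `Φ : [0, ∞) → [0, ∞)` with `Φ 0 = 0` and
`Φ t → ∞` as `t → ∞`. The values at negative arguments are irrelevant. -/
structure YoungFunction where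
  toFun : ℝ → ℝ
  convexOn : ConvexOn ℝ (Set.Ici 0) toFun
  map_zero : toFun 0 = 0
  nonneg : ∀ t, 0 ≤ t → 0 ≤ toFun t
  tendsto_atTop : Filter.Tendsto toFun Filter.atTop Filter.atTop

namespace YoungFunction

instance : CoeFun YoungFunction (fun _ => ℝ → ℝ) := ⟨toFun⟩

/-- The complementary Young function `Ψ t = sup_{s ≥ 0} (s t - Φ s)`, with values in `[0, ∞]`
(the supremum is nonnegative because of `s = 0`). -/
def complementary (Φ : YoungFunction) (t : ℝ) : ℝ≥0∞ :=
  ⨆ (s : ℝ) (_ : 0 ≤ s), ENNReal.ofReal (s * t - Φ s)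

variable {α : Type*} [MeasurableSpace α]

/-- The modular `σ(v; Ψ) = ∫ Ψ(|v|) dμ`, where `Ψ` is complementary to `Φ`. -/
def complementaryModular (Φ : YoungFunction) (μ : Measure α) (v : α → ℝ) : ℝ≥0∞ :=
  ∫⁻ x, Φ.complementary |v x| ∂μ

/-- The Orlicz norm `‖u‖_Φ = sup { ∫ |u v| dμ : v measurable, σ(v; Ψ) ≤ 1 }`, with value `∞`
allowed. -/
def orliczENorm (Φ : YoungFunction) (μ : Measure α) (u : α → ℝ) : ℝ≥0∞ :=
  ⨆ (v : α → ℝ) (_ : AEMeasurable v μ) (_ : Φ.complementaryModular μ v ≤ 1),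
    ∫⁻ x, ‖u x * v x‖ₑ ∂μ

variable (Φ : YoungFunction) (μ : Measure α)

theorem le_orliczENorm (u : α → ℝ) {v : α → ℝ} (hv : AEMeasurable v μ)
    (hm : Φ.complementaryModular μ v ≤ 1) :
    ∫⁻ x, ‖u x * v x‖ₑ ∂μ ≤ Φ.orliczENorm μ u :=
  le_iSup_of_le v (le_iSup_of_le hv
    (le_iSup (fun _ : Φ.complementaryModular μ v ≤ 1 => ∫⁻ x, ‖u x * v x‖ₑ ∂μ) hm))

theorem orliczENorm_congr {u w : α → ℝ} (h : u =ᵐ[μ] w) :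
    Φ.orliczENorm μ u = Φ.orliczENorm μ w := by
  unfold orliczENorm
  refine iSup_congr fun v => iSup_congr fun _ => iSup_congr fun _ => lintegral_congr_ae ?_
  filter_upwards [h] with x hx
  rw [hx]

theorem orliczENorm_add_le {u w : α → ℝ} (hu : AEMeasurable u μ) :
    Φ.orliczENorm μ (fun x => u x + w x) ≤ Φ.orliczENorm μ u + Φ.orliczENorm μ w := by
  refine iSup_le fun v => iSup_le fun hv => iSup_le fun hm => ?_
  calc ∫⁻ x, ‖(u x + w x) * v x‖ₑ ∂μ ≤ ∫⁻ x, (‖u x * v x‖ₑ + ‖w x * v x‖ₑ) ∂μ := by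
        refine lintegral_mono fun x => ?_
        rw [add_mul]
        exact enorm_add_le _ _
    _ = ∫⁻ x, ‖u x * v x‖ₑ ∂μ + ∫⁻ x, ‖w x * v x‖ₑ ∂μ :=
        lintegral_add_left' (hu.mul hv).enorm _
    _ ≤ _ := add_le_add (Φ.le_orliczENorm μ u hv hm) (Φ.le_orliczENorm μ w hv hm)

theorem orliczENorm_smul_le (c : ℝ) (u : α → ℝ) :
    Φ.orliczENorm μ (fun x => c * u x) ≤ ‖c‖ₑ * Φ.orliczENorm μ u := by
  refine iSup_le fun v => iSup_le fun hv => iSup_le fun hm => ?_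
  calc ∫⁻ x, ‖c * u x * v x‖ₑ ∂μ = ∫⁻ x, ‖c‖ₑ * ‖u x * v x‖ₑ ∂μ := by
        refine lintegral_congr fun x => ?_
        rw [mul_assoc, enorm_mul]
    _ = ‖c‖ₑ * ∫⁻ x, ‖u x * v x‖ₑ ∂μ := lintegral_const_mul' _ _ enorm_ne_top
    _ ≤ _ := by
        gcongr
        exact Φ.le_orliczENorm μ u hv hm

theorem complementary_zero : Φ.complementary 0 = 0 := by
  unfold complementary
  simp only [mul_zero, zero_sub, ENNReal.iSup_eq_zero]
  intro s hs
  exact ENNReal.ofReal_of_nonpos (by linarith [Φ.nonneg s hs])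

/-- The complementary function takes arbitrarily small values at positive arguments. -/
theorem exists_complementary_le (ε : ℝ) (hε : 0 < ε) :
    ∃ t : ℝ, 0 < t ∧ Φ.complementary t ≤ ENNReal.ofReal ε := by
  obtain ⟨s₀, hs₀, hΦ⟩ : ∃ s₀ : ℝ, 0 < s₀ ∧ 0 < Φ s₀ := by
    obtain ⟨s, h1, h2⟩ :=
      ((Filter.eventually_gt_atTop (0 : ℝ)).and (Φ.tendsto_atTop.eventually_gt_atTop 0)).exists
    exact ⟨s, h1, h2⟩
  set a := Φ s₀ / s₀ with ha
  have hapos : 0 < a := div_pos hΦ hs₀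
  have haS : a * s₀ = Φ s₀ := by rw [ha]; field_simp
  have bound : ∀ s, 0 ≤ s → s * a - Φ s ≤ Φ s₀ := by
    intro s hs
    rcases le_total s s₀ with h | h
    · nlinarith [Φ.nonneg s hs]
    · have hspos : 0 < s := lt_of_lt_of_le hs₀ h
      have hb : 0 ≤ 1 - s₀ / s := by rw [sub_nonneg, div_le_one hspos]; exact h
      have hb' : 0 ≤ s₀ / s := by positivity
      have hc := Φ.convexOn.2 (Set.mem_Ici.2 (le_refl (0 : ℝ))) (Set.mem_Ici.2 hs) hb hb'
        (by ring)
      have e : (1 - s₀ / s) • (0 : ℝ) + (s₀ / s) • s = s₀ := by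
        simp only [smul_eq_mul, mul_zero, zero_add]; field_simp
      rw [e, Φ.map_zero] at hc
      simp only [smul_eq_mul, mul_zero, zero_add] at hc
      have h2 : Φ s₀ * s ≤ s₀ * Φ s := by
        have := mul_le_mul_of_nonneg_right hc hspos.le
        calc Φ s₀ * s ≤ s₀ / s * Φ s * s := this
          _ = s₀ * Φ s := by field_simp
      have h3 : s * a ≤ Φ s := by
        rw [ha, mul_div_assoc', div_le_iff₀ hs₀]; linarith
      linarith
  set l := min 1 (ε / Φ s₀) with hl
  have hlpos : 0 < l := lt_min one_pos (div_pos hε hΦ)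
  refine ⟨l * a, mul_pos hlpos hapos, iSup_le fun s => iSup_le fun hs => ?_⟩
  refine ENNReal.ofReal_le_ofReal ?_
  have h1 : l ≤ 1 := min_le_left _ _
  have h2 : l * Φ s₀ ≤ ε := by
    have := min_le_right 1 (ε / Φ s₀)
    rw [← hl, le_div_iff₀ hΦ] at this
    exact this
  have h3 := mul_le_mul_of_nonneg_left (bound s hs) hlpos.le
  nlinarith [Φ.nonneg s hs]

theorem ae_eq_zero_of_orliczENorm [SigmaFinite μ] {u : α → ℝ} (hu : AEMeasurable u μ)
    (h : Φ.orliczENorm μ u = 0) : u =ᵐ[μ] 0 := by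
  have key : ∀ n : ℕ, ∀ᵐ x ∂μ, x ∈ spanningSets μ n → u x = 0 := by
    intro n
    set A := spanningSets μ n with hA
    have hAm : MeasurableSet A := measurableSet_spanningSets μ n
    have hAf : μ A < ∞ := measure_spanningSets_lt_top μ n
    set m := (μ A).toReal with hm
    have hm0 : 0 ≤ m := ENNReal.toReal_nonneg
    obtain ⟨t, ht, hΨ⟩ := Φ.exists_complementary_le (1 / (m + 1)) (by positivity)
    set v : α → ℝ := A.indicator (fun _ => t) with hv
    have hvm : AEMeasurable v μ := (measurable_const.indicator hAm).aemeasurable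
    have hmod : Φ.complementaryModular μ v ≤ 1 := by
      unfold complementaryModular
      calc ∫⁻ x, Φ.complementary |v x| ∂μ
          = ∫⁻ x, A.indicator (fun _ => Φ.complementary t) x ∂μ := by
            refine lintegral_congr fun x => ?_
            by_cases hx : x ∈ A
            · simp [hv, hx, abs_of_pos ht]
            · simp [hv, hx, complementary_zero]
        _ = Φ.complementary t * μ A := by rw [lintegral_indicator_const hAm]
        _ ≤ ENNReal.ofReal (1 / (m + 1)) * ENNReal.ofReal m := by
            gcongr
            rw [hm, ENNReal.ofReal_toReal hAf.ne]
        _ ≤ 1 := by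
            rw [← ENNReal.ofReal_mul (by positivity)]
            refine ENNReal.ofReal_le_one.2 ?_
            rw [one_div, inv_mul_le_iff₀ (by positivity)]
            linarith
    have h0 : ∫⁻ x, ‖u x * v x‖ₑ ∂μ = 0 := by
      refine le_antisymm ?_ bot_le
      rw [← h]
      exact Φ.le_orliczENorm μ u hvm hmod
    replace h0 := (lintegral_eq_zero_iff' (hu.mul hvm).enorm).1 h0
    filter_upwards [h0] with x hx hxA
    simpa [hv, hxA, ht.ne'] using hx
  filter_upwards [ae_all_iff.2 key] with x hx
  have hmem : x ∈ ⋃ n, spanningSets μ n := by rw [iUnion_spanningSets]; trivial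
  obtain ⟨n, hn⟩ := Set.mem_iUnion.1 hmem
  exact hx n hn

theorem orliczENorm_aeeqFun_add_le (u w : α →ₘ[μ] ℝ) :
    Φ.orliczENorm μ (u + w : α →ₘ[μ] ℝ) ≤ Φ.orliczENorm μ u + Φ.orliczENorm μ w := by
  rw [Φ.orliczENorm_congr μ (AEEqFun.coeFn_add u w)]
  exact Φ.orliczENorm_add_le μ u.aemeasurable

theorem orliczENorm_aeeqFun_smul_le (c : ℝ) (u : α →ₘ[μ] ℝ) :
    Φ.orliczENorm μ (c • u : α →ₘ[μ] ℝ) ≤ ‖c‖ₑ * Φ.orliczENorm μ u := by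
  rw [Φ.orliczENorm_congr μ (AEEqFun.coeFn_smul c u)]
  exact Φ.orliczENorm_smul_le μ c u

/-- The Orlicz space `L_Φ(μ)`: classes of a.e. equal measurable functions of finite Orlicz norm. -/
def orliczSpace : Submodule ℝ (α →ₘ[μ] ℝ) where
  carrier := {u | Φ.orliczENorm μ u < ∞}
  add_mem' {u w} hu hw :=
    (Φ.orliczENorm_aeeqFun_add_le μ u w).trans_lt (ENNReal.add_lt_top.2 ⟨hu, hw⟩)
  zero_mem' := by
    have h := Φ.orliczENorm_aeeqFun_smul_le μ 0 0
    rw [zero_smul] at h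
    refine lt_of_le_of_lt h ?_
    simp
  smul_mem' c u hu :=
    (Φ.orliczENorm_aeeqFun_smul_le μ c u).trans_lt (ENNReal.mul_lt_top enorm_lt_top hu)

instance : Norm (Φ.orliczSpace μ) := ⟨fun u => (Φ.orliczENorm μ (u : α →ₘ[μ] ℝ)).toReal⟩

theorem orliczSpace_core [SigmaFinite μ] : NormedSpace.Core ℝ (Φ.orliczSpace μ) :=
  normCoreOfENorm (Φ.orliczSpace μ) (fun u : α →ₘ[μ] ℝ => Φ.orliczENorm μ u) (fun _ => rfl)
    (fun _ hu => ne_of_lt hu) (Φ.orliczENorm_aeeqFun_add_le μ) (Φ.orliczENorm_aeeqFun_smul_le μ)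
    (fun u hu => AEEqFun.ext
      ((Φ.ae_eq_zero_of_orliczENorm μ u.aemeasurable hu).trans AEEqFun.coeFn_zero.symm))

instance [SigmaFinite μ] : NormedAddCommGroup (Φ.orliczSpace μ) :=
  NormedAddCommGroup.ofCore (Φ.orliczSpace_core μ)

instance [SigmaFinite μ] : NormedSpace ℝ (Φ.orliczSpace μ) :=
  NormedSpace.ofCore (Φ.orliczSpace_core μ)

end YoungFunction

/-! ### The space `W₀^{1,q} ∩ L^∞` on an open set -/

section Sobolev

variable {d : ℕ} (Ω : Opens (EuclideanSpace ℝ (Fin d)))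

/-- `g` is a weak gradient of `u` on `Ω`: both are locally integrable on `Ω`, and
`∫_Ω u ∂_v φ = - ∫_Ω φ (g · v)` for all test functions `φ ∈ C_c^∞(Ω)` and all directions `v`. -/
structure HasWeakGradient (u : EuclideanSpace ℝ (Fin d) → ℝ)
    (g : EuclideanSpace ℝ (Fin d) → EuclideanSpace ℝ (Fin d)) : Prop where
  locallyIntegrableOn : LocallyIntegrableOn u Ω
  locallyIntegrableOn_grad : LocallyIntegrableOn g Ω
  integral_eq : ∀ (φ : 𝓓(Ω, ℝ)) (v : EuclideanSpace ℝ (Fin d)),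
    ∫ x in Ω, u x * fderiv ℝ φ x v = - ∫ x in Ω, φ x * inner ℝ (g x) v

/-- The norm `‖u‖_{L^q(Ω)} + ‖∇u‖_{L^q(Ω)}` of `W^{1,q}(Ω)`, with value `∞` if `u` has no weak
gradient. The weak gradient is unique a.e. in `Ω`, so that the infimum is over equal numbers. -/
def sobolevENorm (q : ℝ≥0∞) (u : EuclideanSpace ℝ (Fin d) → ℝ) : ℝ≥0∞ :=
  ⨅ (g : EuclideanSpace ℝ (Fin d) → EuclideanSpace ℝ (Fin d)) (_ : HasWeakGradient Ω u g),
    (eLpNorm u q (volume.restrict Ω) + eLpNorm g q (volume.restrict Ω))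

/-- The norm `max {‖u‖_{W^{1,q}(Ω)}, ‖u‖_{L^∞(Ω)}}`. -/
def sobolevLinftyENorm (q : ℝ≥0∞) (u : EuclideanSpace ℝ (Fin d) → ℝ) : ℝ≥0∞ :=
  max (sobolevENorm Ω q u) (eLpNorm u ∞ (volume.restrict Ω))

/-- `u` belongs to the closure of `C_c^∞(Ω)` in `W^{1,q}(Ω)`. -/
def IsSobolevZero (q : ℝ≥0∞) (u : EuclideanSpace ℝ (Fin d) → ℝ) : Prop :=
  sobolevENorm Ω q u < ∞ ∧
    ∀ ε : ℝ≥0∞, 0 < ε → ∃ φ : 𝓓(Ω, ℝ), sobolevENorm Ω q (fun x => u x - φ x) < ε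

variable {Ω}

/-- A locally integrable function times a continuous function with compact support in `Ω` is
integrable on `Ω`. -/
theorem integrableOn_mul_of_compactSupport {u ψ : EuclideanSpace ℝ (Fin d) → ℝ}
    (hu : LocallyIntegrableOn u Ω) (hψ : Continuous ψ) (hc : HasCompactSupport ψ)
    (hs : tsupport ψ ⊆ Ω) : IntegrableOn (fun x => u x * ψ x) Ω := by
  have h1 : IntegrableOn u (tsupport ψ) :=
    hu.integrableOn_compact_subset hs hc
  have h2 : IntegrableOn (fun x => u x * ψ x) (tsupport ψ) :=
    h1.mul_continuousOn hψ.continuousOn hc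
  have h3 : Integrable (fun x => u x * ψ x) := by
    refine (integrableOn_iff_integrable_of_support_subset ?_).1 h2
    intro x hx
    refine subset_tsupport ψ ?_
    intro h0
    exact hx (by simp [h0])
  exact h3.integrableOn

theorem integrableOn_mul_fderiv {u : EuclideanSpace ℝ (Fin d) → ℝ}
    (hu : LocallyIntegrableOn u Ω) (φ : 𝓓(Ω, ℝ)) (v : EuclideanSpace ℝ (Fin d)) :
    IntegrableOn (fun x => u x * fderiv ℝ φ x v) Ω := by
  have hφ : ContDiff ℝ 1 φ := φ.contDiff.of_le (by exact_mod_cast le_top)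
  have hsub : tsupport (fun x => fderiv ℝ φ x v) ⊆ tsupport φ :=
    closure_minimal (fun x hx => support_fderiv_subset ℝ (fun h0 => hx (by simp [h0])))
      (isClosed_tsupport _)
  exact integrableOn_mul_of_compactSupport hu
    ((hφ.continuous_fderiv one_ne_zero).clm_apply continuous_const)
    (IsCompact.of_isClosed_subset φ.hasCompactSupport (isClosed_tsupport _) hsub)
    (hsub.trans φ.tsupport_subset)

theorem integrableOn_mul_inner {g : EuclideanSpace ℝ (Fin d) → EuclideanSpace ℝ (Fin d)}
    (hg : LocallyIntegrableOn g Ω) (φ : 𝓓(Ω, ℝ)) (v : EuclideanSpace ℝ (Fin d)) :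
    IntegrableOn (fun x => φ x * inner ℝ (g x) v) Ω := by
  have h : LocallyIntegrableOn (fun x => inner ℝ (g x) v) (Ω : Set (EuclideanSpace ℝ (Fin d))) := by
    intro x hx
    obtain ⟨s, hs, hi⟩ := hg x hx
    exact ⟨s, hs, Integrable.inner_const hi v⟩
  simpa only [mul_comm] using
    integrableOn_mul_of_compactSupport h φ.continuous φ.hasCompactSupport φ.tsupport_subset

theorem HasWeakGradient.add {u w : EuclideanSpace ℝ (Fin d) → ℝ}
    {g h : EuclideanSpace ℝ (Fin d) → EuclideanSpace ℝ (Fin d)}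
    (hu : HasWeakGradient Ω u g) (hw : HasWeakGradient Ω w h) :
    HasWeakGradient Ω (fun x => u x + w x) (fun x => g x + h x) where
  locallyIntegrableOn := hu.locallyIntegrableOn.add hw.locallyIntegrableOn
  locallyIntegrableOn_grad := hu.locallyIntegrableOn_grad.add hw.locallyIntegrableOn_grad
  integral_eq φ v := by
    simp only [add_mul, inner_add_left, mul_add]
    rw [integral_add (integrableOn_mul_fderiv hu.locallyIntegrableOn φ v)
        (integrableOn_mul_fderiv hw.locallyIntegrableOn φ v),
      integral_add (integrableOn_mul_inner hu.locallyIntegrableOn_grad φ v)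
        (integrableOn_mul_inner hw.locallyIntegrableOn_grad φ v),
      hu.integral_eq, hw.integral_eq]
    ring

theorem HasWeakGradient.const_smul {u : EuclideanSpace ℝ (Fin d) → ℝ}
    {g : EuclideanSpace ℝ (Fin d) → EuclideanSpace ℝ (Fin d)}
    (hu : HasWeakGradient Ω u g) (c : ℝ) :
    HasWeakGradient Ω (fun x => c * u x) (fun x => c • g x) where
  locallyIntegrableOn := hu.locallyIntegrableOn.smul c
  locallyIntegrableOn_grad := hu.locallyIntegrableOn_grad.smul c
  integral_eq φ v := by
    simp only [real_inner_smul_left, mul_assoc, mul_left_comm _ c]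
    rw [integral_const_mul, integral_const_mul, hu.integral_eq]
    ring

theorem HasWeakGradient.congr {u w : EuclideanSpace ℝ (Fin d) → ℝ}
    {g : EuclideanSpace ℝ (Fin d) → EuclideanSpace ℝ (Fin d)}
    (hu : HasWeakGradient Ω u g) (h : u =ᵐ[volume.restrict Ω] w) : HasWeakGradient Ω w g where
  locallyIntegrableOn := by
    intro x hx
    obtain ⟨s, hs, hi⟩ := hu.locallyIntegrableOn x hx
    refine ⟨s ∩ Ω, Filter.inter_mem hs self_mem_nhdsWithin, ?_⟩
    refine (hi.mono_set Set.inter_subset_left).congr_fun_ae ?_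
    exact ae_restrict_of_ae_restrict_of_subset Set.inter_subset_right h
  locallyIntegrableOn_grad := hu.locallyIntegrableOn_grad
  integral_eq φ v := by
    rw [← hu.integral_eq φ v]
    refine integral_congr_ae ?_
    filter_upwards [h] with x hx
    rw [hx]

theorem hasWeakGradient_zero :
    HasWeakGradient Ω (fun _ => 0) (fun _ => 0) where
  locallyIntegrableOn := (locallyIntegrable_const 0).locallyIntegrableOn _
  locallyIntegrableOn_grad := (locallyIntegrable_const 0).locallyIntegrableOn _
  integral_eq φ v := by simp

variable (Ω)

theorem sobolevENorm_congr (q : ℝ≥0∞) {u w : EuclideanSpace ℝ (Fin d) → ℝ}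
    (h : u =ᵐ[volume.restrict Ω] w) : sobolevENorm Ω q u = sobolevENorm Ω q w := by
  unfold sobolevENorm
  refine iInf_congr fun g => ?_
  rw [eLpNorm_congr_ae h]
  exact iInf_congr_Prop ⟨fun k => k.congr h, fun k => k.congr h.symm⟩ fun _ => rfl

theorem sobolevENorm_zero (q : ℝ≥0∞) : sobolevENorm Ω q (fun _ => 0) = 0 := by
  refine le_antisymm ((iInf₂_le _ hasWeakGradient_zero).trans ?_) bot_le
  simp

theorem HasWeakGradient.aestronglyMeasurable {u : EuclideanSpace ℝ (Fin d) → ℝ}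
    {g : EuclideanSpace ℝ (Fin d) → EuclideanSpace ℝ (Fin d)} (hu : HasWeakGradient Ω u g) :
    AEStronglyMeasurable u (volume.restrict Ω) ∧ AEStronglyMeasurable g (volume.restrict Ω) :=
  ⟨hu.locallyIntegrableOn.aestronglyMeasurable, hu.locallyIntegrableOn_grad.aestronglyMeasurable⟩

theorem sobolevENorm_add_le (q : ℝ≥0∞) (hq : 1 ≤ q) (u w : EuclideanSpace ℝ (Fin d) → ℝ) :
    sobolevENorm Ω q (fun x => u x + w x) ≤ sobolevENorm Ω q u + sobolevENorm Ω q w := by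
  unfold sobolevENorm
  simp_rw [ENNReal.iInf_add, ENNReal.add_iInf]
  refine le_iInf₂ fun g hg => le_iInf₂ fun h hh => ?_
  refine (iInf₂_le _ (hg.add hh)).trans ?_
  have h1 := eLpNorm_add_le (hg.aestronglyMeasurable Ω).1 (hh.aestronglyMeasurable Ω).1 hq
  have h2 := eLpNorm_add_le (hg.aestronglyMeasurable Ω).2 (hh.aestronglyMeasurable Ω).2 hq
  exact (add_le_add h1 h2).trans_eq (add_add_add_comm _ _ _ _)

theorem sobolevENorm_smul_le (q : ℝ≥0∞) (c : ℝ) (u : EuclideanSpace ℝ (Fin d) → ℝ) :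
    sobolevENorm Ω q (fun x => c * u x) ≤ ‖c‖ₑ * sobolevENorm Ω q u := by
  by_cases hc : c = 0
  · simp [hc, sobolevENorm_zero]
  have hc' : ‖c‖ₑ ≠ 0 := by simpa using hc
  unfold sobolevENorm
  simp_rw [ENNReal.mul_iInf_of_ne hc' enorm_ne_top]
  refine le_iInf₂ fun g hg => (iInf₂_le _ (hg.const_smul c)).trans ?_
  rw [mul_add]
  exact add_le_add (eLpNorm_const_smul_le (c := c) (f := u))
    (eLpNorm_const_smul_le (c := c) (f := g))

theorem sobolevLinftyENorm_add_le (q : ℝ≥0∞) (hq : 1 ≤ q)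
    (u w : EuclideanSpace ℝ (Fin d) →ₘ[volume.restrict (Ω : Set (EuclideanSpace ℝ (Fin d)))] ℝ) :
    sobolevLinftyENorm Ω q (u + w : _ →ₘ[_] ℝ) ≤
      sobolevLinftyENorm Ω q u + sobolevLinftyENorm Ω q w := by
  unfold sobolevLinftyENorm
  rw [sobolevENorm_congr Ω q (AEEqFun.coeFn_add u w), eLpNorm_congr_ae (AEEqFun.coeFn_add u w)]
  refine max_le ((sobolevENorm_add_le Ω q hq u w).trans ?_)
    ((eLpNorm_add_le u.aestronglyMeasurable w.aestronglyMeasurable le_top).trans ?_)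
  · exact add_le_add (le_max_left _ _) (le_max_left _ _)
  · exact add_le_add (le_max_right _ _) (le_max_right _ _)

theorem sobolevLinftyENorm_smul_le (q : ℝ≥0∞) (c : ℝ)
    (u : EuclideanSpace ℝ (Fin d) →ₘ[volume.restrict (Ω : Set (EuclideanSpace ℝ (Fin d)))] ℝ) :
    sobolevLinftyENorm Ω q (c • u : _ →ₘ[_] ℝ) ≤ ‖c‖ₑ * sobolevLinftyENorm Ω q u := by
  unfold sobolevLinftyENorm
  rw [sobolevENorm_congr Ω q (AEEqFun.coeFn_smul c u), eLpNorm_congr_ae (AEEqFun.coeFn_smul c u)]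
  refine max_le ((sobolevENorm_smul_le Ω q c u).trans ?_) (eLpNorm_const_smul_le.trans ?_)
  · gcongr; exact le_max_left _ _
  · gcongr; exact le_max_right _ _

theorem IsSobolevZero.congr {q : ℝ≥0∞} {u w : EuclideanSpace ℝ (Fin d) → ℝ}
    (hu : IsSobolevZero Ω q u) (h : u =ᵐ[volume.restrict Ω] w) : IsSobolevZero Ω q w := by
  refine ⟨(sobolevENorm_congr Ω q h) ▸ hu.1, fun ε hε => ?_⟩
  obtain ⟨φ, hφ⟩ := hu.2 ε hε
  refine ⟨φ, lt_of_eq_of_lt (sobolevENorm_congr Ω q ?_) hφ⟩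
  filter_upwards [h] with x hx
  rw [hx]

theorem IsSobolevZero.add {q : ℝ≥0∞} (hq : 1 ≤ q) {u w : EuclideanSpace ℝ (Fin d) → ℝ}
    (hu : IsSobolevZero Ω q u) (hw : IsSobolevZero Ω q w) :
    IsSobolevZero Ω q (fun x => u x + w x) := by
  refine ⟨(sobolevENorm_add_le Ω q hq u w).trans_lt (ENNReal.add_lt_top.2 ⟨hu.1, hw.1⟩),
    fun ε hε => ?_⟩
  have hε' : 0 < ε / 2 := ENNReal.half_pos hε.ne'
  obtain ⟨φ, hφ⟩ := hu.2 _ hε'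
  obtain ⟨ψ, hψ⟩ := hw.2 _ hε'
  refine ⟨φ + ψ, ?_⟩
  have e : (fun x => u x + w x - (φ + ψ) x) = fun x => (u x - φ x) + (w x - ψ x) := by
    funext x
    rw [show (φ + ψ) x = φ x + ψ x from rfl]
    ring
  rw [e, ← ENNReal.add_halves ε]
  exact (sobolevENorm_add_le Ω q hq _ _).trans_lt (ENNReal.add_lt_add hφ hψ)

theorem isSobolevZero_zero (q : ℝ≥0∞) : IsSobolevZero Ω q (fun _ => 0) := by
  refine ⟨by simp [sobolevENorm_zero], fun ε hε => ⟨0, ?_⟩⟩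
  have e : (fun x => (0 : ℝ) - (0 : 𝓓(Ω, ℝ)) x) = fun _ => 0 := by
    funext x
    rw [show (0 : 𝓓(Ω, ℝ)) x = 0 from rfl, sub_zero]
  rwa [e, sobolevENorm_zero]

theorem IsSobolevZero.const_mul {q : ℝ≥0∞} {u : EuclideanSpace ℝ (Fin d) → ℝ}
    (hu : IsSobolevZero Ω q u) (c : ℝ) : IsSobolevZero Ω q (fun x => c * u x) := by
  by_cases hc : c = 0
  · simpa [hc] using isSobolevZero_zero Ω q
  have hc' : ‖c‖ₑ ≠ 0 := by simpa using hc
  refine ⟨(sobolevENorm_smul_le Ω q c u).trans_lt (ENNReal.mul_lt_top enorm_lt_top hu.1),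
    fun ε hε => ?_⟩
  obtain ⟨φ, hφ⟩ := hu.2 (ε / ‖c‖ₑ) (ENNReal.div_pos hε.ne' enorm_ne_top)
  refine ⟨c • φ, ?_⟩
  have e : (fun x => c * u x - (c • φ) x) = fun x => c * (u x - φ x) := by
    funext x
    rw [show (c • φ) x = c * φ x from rfl]
    ring
  rw [e]
  refine (sobolevENorm_smul_le Ω q c _).trans_lt ?_
  rw [mul_comm]
  exact (ENNReal.lt_div_iff_mul_lt (Or.inl hc') (Or.inl enorm_ne_top)).1 hφ

/-- The space `W₀^{1,q}(Ω) ∩ L^∞(Ω)` of classes of a.e. equal functions on `Ω`, normed by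
`max {‖u‖_{W^{1,q}(Ω)}, ‖u‖_{L^∞(Ω)}}`. -/
def sobolevZeroLinfty (q : ℝ≥0∞) [hq : Fact (1 ≤ q)] :
    Submodule ℝ
      (EuclideanSpace ℝ (Fin d) →ₘ[volume.restrict (Ω : Set (EuclideanSpace ℝ (Fin d)))] ℝ) where
  carrier := {u | IsSobolevZero Ω q u ∧ eLpNorm u ∞ (volume.restrict Ω) < ∞}
  add_mem' {u w} hu hw := by
    refine ⟨(hu.1.add Ω hq.out hw.1).congr Ω (AEEqFun.coeFn_add u w).symm, ?_⟩
    rw [eLpNorm_congr_ae (AEEqFun.coeFn_add u w)]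
    exact eLpNorm_add_lt_top ⟨u.aestronglyMeasurable, hu.2⟩ ⟨w.aestronglyMeasurable, hw.2⟩
  zero_mem' := by
    refine ⟨(isSobolevZero_zero Ω q).congr Ω AEEqFun.coeFn_zero.symm, ?_⟩
    rw [eLpNorm_congr_ae AEEqFun.coeFn_zero]
    simp
  smul_mem' c u hu := by
    refine ⟨(hu.1.const_mul Ω c).congr Ω (AEEqFun.coeFn_smul c u).symm, ?_⟩
    rw [eLpNorm_congr_ae (AEEqFun.coeFn_smul c u)]
    exact eLpNorm_const_smul_le.trans_lt (ENNReal.mul_lt_top enorm_lt_top hu.2)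

variable (q : ℝ≥0∞) [Fact (1 ≤ q)]

instance : Norm (sobolevZeroLinfty Ω q) :=
  ⟨fun u => (sobolevLinftyENorm Ω q (u : EuclideanSpace ℝ (Fin d) →ₘ[volume.restrict Ω] ℝ)).toReal⟩

theorem sobolevZeroLinfty_core : NormedSpace.Core ℝ (sobolevZeroLinfty Ω q) :=
  normCoreOfENorm (sobolevZeroLinfty Ω q)
    (fun u : EuclideanSpace ℝ (Fin d) →ₘ[volume.restrict Ω] ℝ => sobolevLinftyENorm Ω q u)
    (fun _ => rfl) (fun _ hu => ne_of_lt (max_lt hu.1.1 hu.2))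
    (sobolevLinftyENorm_add_le Ω q Fact.out) (sobolevLinftyENorm_smul_le Ω q)
    (fun u hu => by
      have h0 : eLpNorm u ∞ (volume.restrict Ω) = 0 :=
        le_antisymm ((le_max_right _ _).trans_eq hu) bot_le
      rw [eLpNorm_eq_zero_iff u.aestronglyMeasurable (by simp)] at h0
      exact AEEqFun.ext (h0.trans AEEqFun.coeFn_zero.symm))

instance : NormedAddCommGroup (sobolevZeroLinfty Ω q) :=
  NormedAddCommGroup.ofCore (sobolevZeroLinfty_core Ω q)

instance : NormedSpace ℝ (sobolevZeroLinfty Ω q) :=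
  NormedSpace.ofCore (sobolevZeroLinfty_core Ω q)

end Sobolev

end

/-! On uniformly bounded functions the Orlicz norm is continuous with respect to the `L¹` norm, with
no growth condition on Φ. Indeed, if |w| ≤ R, Young's inequality gives k|w||v| ≤ Φ(k|w|) + Ψ(|v|),
and convexity gives Φ(k|w|) ≤ (|w|/R) Φ(kR). Integration yields k‖w‖_Φ ≤ (Φ(kR)/R)‖w‖₁ + 1
(`YoungFunction.ofReal_mul_orliczENorm_le`). The choice k = 1/R bounds the embedding; a large k,
followed by a small ‖w‖₁, gives the continuity.

It remains to show that the unit ball of X is totally bounded in `L¹(Ω)`. Its elements are `L¹`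
limits of test functions with a uniform `W^{1,1}` bound. Test functions extend by zero to the whole
space, so the boundary of Ω plays no role. For such functions `measure_ball_mul_lintegral_enorm_le`
bounds the `L¹` norm on Ω by a small multiple of the `L¹` norm of the gradient plus the integrals
over finitely many small balls. These integrals form a bounded vector in a finite-dimensional space,
hence Rellich's theorem `totallyBounded_of_approx_contDiff`.

The `L¹` closure of the unit ball is then compact and still bounded by 1 a.e., so its image in `L_Φ`
is compact. -/

/-! ### Orlicz norm of bounded functions -/

theorem YoungFunction.apply_mul_le (Φ : YoungFunction) {s c : ℝ} (hs : 0 ≤ s) (hc₀ : 0 ≤ c)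
    (hc₁ : c ≤ 1) : Φ (c * s) ≤ c * Φ s := by
  have h := Φ.convexOn.2 (Set.mem_Ici.2 (le_refl (0 : ℝ))) (Set.mem_Ici.2 hs)
    (sub_nonneg.2 hc₁) hc₀ (by ring)
  simpa [Φ.map_zero] using h

/-- Young's inequality, in extended nonnegative reals. -/
theorem YoungFunction.ofReal_mul_le (Φ : YoungFunction) {s : ℝ} (hs : 0 ≤ s) (t : ℝ) :
    ENNReal.ofReal (s * t) ≤ ENNReal.ofReal (Φ s) + Φ.complementary t := by
  calc ENNReal.ofReal (s * t) = ENNReal.ofReal (Φ s + (s * t - Φ s)) := by ring_nf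
    _ ≤ ENNReal.ofReal (Φ s) + ENNReal.ofReal (s * t - Φ s) := ENNReal.ofReal_add_le
    _ ≤ _ := by
      gcongr
      exact le_iSup₂ (f := fun (s : ℝ) (_ : 0 ≤ s) => ENNReal.ofReal (s * t - Φ s)) s hs

/-- On bounded functions the Orlicz norm is controlled by the `L¹` norm. -/
theorem YoungFunction.ofReal_mul_orliczENorm_le {α : Type*} [MeasurableSpace α]
    (Φ : YoungFunction) (μ : Measure α) {w : α → ℝ} (hw : AEMeasurable w μ) {k R : ℝ}
    (hk : 0 < k) (hR : 0 < R) (hwR : ∀ᵐ x ∂μ, |w x| ≤ R) :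
    ENNReal.ofReal k * Φ.orliczENorm μ w ≤
      ENNReal.ofReal (Φ (k * R) / R) * ∫⁻ x, ‖w x‖ₑ ∂μ + 1 := by
  unfold orliczENorm
  simp_rw [ENNReal.mul_iSup]
  refine iSup_le fun v => iSup_le fun hv => iSup_le fun hm => ?_
  rw [← lintegral_const_mul' _ _ ENNReal.ofReal_ne_top,
    ← lintegral_const_mul' _ _ ENNReal.ofReal_ne_top]
  calc ∫⁻ x, ENNReal.ofReal k * ‖w x * v x‖ₑ ∂μ
      ≤ ∫⁻ x, (ENNReal.ofReal (Φ (k * R) / R) * ‖w x‖ₑ + Φ.complementary |v x|) ∂μ := by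
        refine lintegral_mono_ae ?_
        filter_upwards [hwR] with x hx
        have e : ENNReal.ofReal k * ‖w x * v x‖ₑ = ENNReal.ofReal (k * |w x| * |v x|) := by
          rw [Real.enorm_eq_ofReal_abs, abs_mul, ← ENNReal.ofReal_mul hk.le, mul_assoc]
        rw [e]
        refine (Φ.ofReal_mul_le (by positivity) _).trans ?_
        gcongr
        rw [Real.enorm_eq_ofReal_abs, ← ENNReal.ofReal_mul
          (div_nonneg (Φ.nonneg _ (by positivity)) hR.le)]
        refine ENNReal.ofReal_le_ofReal ?_
        -- Since k|w x| = (|w x|/R)(kR) with |w x|/R ≤ 1, convexity makes the bound linear in |w x|.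
        have h := Φ.apply_mul_le (s := k * R) (c := |w x| / R) (by positivity) (by positivity)
          ((div_le_one hR).2 hx)
        have e2 : |w x| / R * (k * R) = k * |w x| := by field_simp
        rw [e2] at h
        refine h.trans_eq ?_
        ring
    _ = ∫⁻ x, ENNReal.ofReal (Φ (k * R) / R) * ‖w x‖ₑ ∂μ + ∫⁻ x, Φ.complementary |v x| ∂μ :=
        lintegral_add_left' (hw.enorm.const_mul _) _
    _ ≤ _ := by gcongr; exact hm

/-! ### Translation and ball-average estimates in `L¹` -/

section Translation

variable {E : Type*} [NormedAddCommGroup E] [NormedSpace ℝ E] [MeasurableSpace E] [BorelSpace E]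

/-- The `L¹` modulus of continuity of a `C¹` function is controlled by its derivative. -/
theorem lintegral_enorm_translate_sub_le [SecondCountableTopology E] (μ : Measure E) [SFinite μ]
    [μ.IsAddRightInvariant]
    {w : E → ℝ} (hw : ContDiff ℝ 1 w) (z : E) :
    ∫⁻ x, ‖w (x + z) - w x‖ₑ ∂μ ≤ ‖z‖ₑ * ∫⁻ x, ‖fderiv ℝ w x‖ₑ ∂μ := by
  have hD : Continuous (fderiv ℝ w) := hw.continuous_fderiv one_ne_zero
  -- The increment is the integral of the derivative along the segment from x to x + z. After
  -- Tonelli, translation invariance removes the shift `t • z`.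
  have pt : ∀ x, ‖w (x + z) - w x‖ₑ ≤
      ∫⁻ t in Set.Ioc (0 : ℝ) 1, ‖z‖ₑ * ‖fderiv ℝ w (x + t • z)‖ₑ := by
    intro x
    have hd : ∀ t ∈ Set.uIcc (0 : ℝ) 1,
        HasDerivAt (fun t : ℝ => w (x + t • z)) (fderiv ℝ w (x + t • z) z) t := by
      intro t _
      have h1 : HasDerivAt (fun t : ℝ => x + t • z) z t := by
        simpa using ((hasDerivAt_id t).smul_const z).const_add x
      exact ((hw.differentiable one_ne_zero _).hasFDerivAt).comp_hasDerivAt t h1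
    have hc : Continuous fun t : ℝ => fderiv ℝ w (x + t • z) z := by fun_prop
    have h := intervalIntegral.integral_eq_sub_of_hasDerivAt hd (hc.intervalIntegrable 0 1)
    simp only [one_smul, zero_smul, add_zero] at h
    rw [← h, intervalIntegral.integral_of_le zero_le_one]
    refine (enorm_integral_le_lintegral_enorm _).trans (lintegral_mono fun t => ?_)
    rw [mul_comm]
    exact ContinuousLinearMap.le_opENorm _ _
  calc ∫⁻ x, ‖w (x + z) - w x‖ₑ ∂μ
      ≤ ∫⁻ x, ∫⁻ t in Set.Ioc (0 : ℝ) 1, ‖z‖ₑ * ‖fderiv ℝ w (x + t • z)‖ₑ ∂volume ∂μ :=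
        lintegral_mono pt
    _ = ∫⁻ t in Set.Ioc (0 : ℝ) 1, ∫⁻ x, ‖z‖ₑ * ‖fderiv ℝ w (x + t • z)‖ₑ ∂μ ∂volume := by
        refine lintegral_lintegral_swap (Continuous.aemeasurable ?_)
        refine ENNReal.continuous_const_mul enorm_ne_top |>.comp ?_
        refine continuous_enorm.comp (hD.comp ?_)
        fun_prop
    _ = ∫⁻ t in Set.Ioc (0 : ℝ) 1, ‖z‖ₑ * ∫⁻ x, ‖fderiv ℝ w x‖ₑ ∂μ := by
        refine lintegral_congr fun t => ?_
        rw [lintegral_const_mul' _ _ enorm_ne_top,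
          lintegral_add_right_eq_self (fun x => ‖fderiv ℝ w x‖ₑ) (t • z)]
    _ = _ := by simp

/-- The `L¹` norm of a `C¹` function on a set covered by balls of radius `r` is
controlled by its derivative and its integrals over these balls. -/
theorem measure_ball_mul_lintegral_enorm_le [FiniteDimensional ℝ E] (μ : Measure E)
    [μ.IsAddHaarMeasure] {w : E → ℝ} (hw : ContDiff ℝ 1 w) {A t : Set E} {r : ℝ}
    (hA : A ⊆ ⋃ c ∈ t, Metric.ball c r) (hAm : MeasurableSet A)
    {M : ℝ≥0∞} (hM : ∀ c ∈ t, ‖∫ x in Metric.ball c r, w x ∂μ‖ₑ ≤ M) :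
    μ (Metric.ball 0 r) * ∫⁻ x in A, ‖w x‖ₑ ∂μ ≤
      μ (Metric.ball 0 (2 * r)) * (ENNReal.ofReal (2 * r) * ∫⁻ x, ‖fderiv ℝ w x‖ₑ ∂μ) +
        M * μ A := by
  have hr0 : μ (Metric.ball 0 r) ≠ ∞ := measure_ball_lt_top.ne
  have hcont := hw.continuous
  -- Compare w x with the integral of w over a covering ball that contains x. That ball lies in the
  -- ball of radius 2r about x, so the error is an integral of increments over a set of z
  -- independent of c.
  have pt : ∀ x ∈ A, μ (Metric.ball 0 r) * ‖w x‖ₑ ≤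
      ∫⁻ z in Metric.ball 0 (2 * r), ‖w (x + z) - w x‖ₑ ∂μ + M := by
    intro x hx
    obtain ⟨c, hc, hxc⟩ := Set.mem_iUnion₂.1 (hA hx)
    rw [Metric.mem_ball] at hxc
    have hi : IntegrableOn w (Metric.ball c r) μ :=
      (hcont.continuousOn.integrableOn_compact (isCompact_closedBall c r)).mono_set
        Metric.ball_subset_closedBall
    have hci : IntegrableOn (fun _ => w x) (Metric.ball c r) μ :=
      integrableOn_const measure_ball_lt_top.ne
    have e : (∫ _ in Metric.ball c r, w x ∂μ) =
        (∫ y in Metric.ball c r, (w x - w y) ∂μ) + ∫ y in Metric.ball c r, w y ∂μ := by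
      rw [integral_sub hci hi]; ring
    have e1 : μ (Metric.ball 0 r) * ‖w x‖ₑ = ‖∫ _ in Metric.ball c r, w x ∂μ‖ₑ := by
      rw [setIntegral_const, enorm_smul, measureReal_def, Measure.addHaar_ball_center μ c r,
        Real.enorm_of_nonneg ENNReal.toReal_nonneg, ENNReal.ofReal_toReal hr0]
    rw [e1, e]
    refine (enorm_add_le _ _).trans (add_le_add ?_ (hM c hc))
    refine (enorm_integral_le_lintegral_enorm _).trans ?_
    have hsub : Metric.ball c r ⊆ Metric.ball x (2 * r) := by
      refine Metric.ball_subset_ball' ?_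
      rw [dist_comm] at hxc; linarith
    have hpre : (fun z => x + z) ⁻¹' Metric.ball x (2 * r) = Metric.ball 0 (2 * r) := by
      ext z; simp
    calc ∫⁻ y in Metric.ball c r, ‖w x - w y‖ₑ ∂μ
        ≤ ∫⁻ y in Metric.ball x (2 * r), ‖w x - w y‖ₑ ∂μ := lintegral_mono_set hsub
      _ = ∫⁻ z in Metric.ball 0 (2 * r), ‖w x - w (x + z)‖ₑ ∂μ := by
          rw [← hpre, (measurePreserving_add_left μ x).setLIntegral_comp_preimage_emb
            (measurableEmbedding_addLeft x) (fun y => ‖w x - w y‖ₑ)]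
      _ = _ := lintegral_congr fun z => enorm_sub_rev _ _
  calc μ (Metric.ball 0 r) * ∫⁻ x in A, ‖w x‖ₑ ∂μ
      = ∫⁻ x in A, μ (Metric.ball 0 r) * ‖w x‖ₑ ∂μ := (lintegral_const_mul' _ _ hr0).symm
    _ ≤ ∫⁻ x in A, (∫⁻ z in Metric.ball 0 (2 * r), ‖w (x + z) - w x‖ₑ ∂μ + M) ∂μ :=
        setLIntegral_mono' hAm pt
    _ = ∫⁻ x in A, ∫⁻ z in Metric.ball 0 (2 * r), ‖w (x + z) - w x‖ₑ ∂μ ∂μ + M * μ A := by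
        rw [lintegral_add_right _ measurable_const, setLIntegral_const]
    -- The x-integral is enlarged to the whole space, where the translation estimate applies.
    _ ≤ ∫⁻ x, ∫⁻ z in Metric.ball 0 (2 * r), ‖w (x + z) - w x‖ₑ ∂μ ∂μ + M * μ A := by
        gcongr; exact Measure.restrict_le_self
    _ = ∫⁻ z in Metric.ball 0 (2 * r), ∫⁻ x, ‖w (x + z) - w x‖ₑ ∂μ ∂μ + M * μ A := by
        congr 1
        refine lintegral_lintegral_swap (Continuous.aemeasurable ?_)
        refine continuous_enorm.comp ?_
        fun_prop
    _ ≤ ∫⁻ _ in Metric.ball (0 : E) (2 * r),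
          (ENNReal.ofReal (2 * r) * ∫⁻ x, ‖fderiv ℝ w x‖ₑ ∂μ) ∂μ + M * μ A := by
        gcongr ?_ + _
        refine setLIntegral_mono' measurableSet_ball fun z hz => ?_
        refine (lintegral_enorm_translate_sub_le μ hw z).trans ?_
        gcongr
        rw [← ofReal_norm]
        exact ENNReal.ofReal_le_ofReal (mem_ball_zero_iff.1 hz).le
    _ = _ := by rw [setLIntegral_const, mul_comm (μ (Metric.ball 0 (2 * r)))]

end Translation

/-! ### Rellich's theorem -/

/-- Rellich's theorem in `L¹`: a set of functions that can be approximated by compactly supported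
`C¹` functions with a uniform `W^{1,1}` bound is totally bounded in `L¹` of a bounded set. -/
theorem totallyBounded_of_approx_contDiff {E : Type*} [NormedAddCommGroup E] [NormedSpace ℝ E]
    [FiniteDimensional ℝ E] [MeasurableSpace E] [BorelSpace E] (μ : Measure E)
    [μ.IsAddHaarMeasure] {A : Set E} (hA : Bornology.IsBounded A) (hAm : MeasurableSet A)
    (C : ℝ≥0) (S : Set (Lp ℝ 1 (μ.restrict A)))
    (h : ∀ f ∈ S, ∀ ε : ℝ≥0∞, 0 < ε → ∃ φ : E → ℝ, ContDiff ℝ 1 φ ∧ HasCompactSupport φ ∧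
      eLpNorm (fun x => f x - φ x) 1 (μ.restrict A) < ε ∧ ∫⁻ x, ‖φ x‖ₑ ∂μ ≤ C ∧
      ∫⁻ x, ‖fderiv ℝ φ x‖ₑ ∂μ ≤ C) :
    TotallyBounded S := by
  have hAfin : μ A ≠ ∞ := hA.measure_lt_top.ne
  refine Metric.totallyBounded_of_finite_discretization fun ε hε => ?_
  set n := Module.finrank ℝ E with hn
  -- The radius makes the gradient term at most ε/4 after division by V: 2ⁿ is the volume ratio of
  -- balls of radii 2r and r, and 2C bounds the gradient of a difference. C + 1 avoids division by
  -- zero.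
  set r : ℝ := ε / (16 * 2 ^ n * (C + 1)) with hr
  have hrpos : 0 < r := by positivity
  have hrC : 2 ^ n * (2 * r * (2 * C)) ≤ ε / 4 := by
    have : 2 ^ n * (2 * r * (2 * C)) = ε / 4 * (C / (C + 1)) := by rw [hr]; field_simp; ring
    rw [this]
    refine mul_le_of_le_one_right (by positivity) ?_
    rw [div_le_one (by positivity)]; linarith
  set V := μ (Metric.ball 0 r) with hV
  have hV0 : V ≠ 0 := (Metric.measure_ball_pos μ 0 hrpos).ne'
  have hVfin : V ≠ ∞ := measure_ball_lt_top.ne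
  have hVpos : 0 < V.toReal := ENNReal.toReal_pos hV0 hVfin
  set a := (μ A).toReal with ha
  have ha0 : 0 ≤ a := ENNReal.toReal_nonneg
  -- Ball integrals that differ by at most 2δ contribute at most ε/4 after division by V.
  set δ : ℝ := V.toReal * ε / (8 * (a + 1)) with hδ
  have hδpos : 0 < δ := by positivity
  have hδa : 2 * δ * a ≤ V.toReal * (ε / 4) := by
    have : 2 * δ * a = V.toReal * (ε / 4) * (a / (a + 1)) := by rw [hδ]; field_simp; ring
    rw [this]
    refine mul_le_of_le_one_right (by positivity) ?_
    rw [div_le_one (by positivity)]; linarith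
  obtain ⟨t, ht, hAt⟩ := Metric.totallyBounded_iff.1
    (hA.isCompact_closure.totallyBounded.subset subset_closure) r hrpos
  have := ht.fintype
  -- Two approximation errors of ε/8 and the bound ε/2 for the difference of the approximants add up
  -- to 3ε/4 < ε.
  choose φ hφd hφc hφf hφC hφD using fun f : S =>
    h f f.2 (ENNReal.ofReal (ε / 8)) (by simpa using hε)
  have hφi : ∀ f, Integrable (φ f) μ := fun f =>
    (hφd f).continuous.integrable_of_hasCompactSupport (hφc f)
  -- The vector of ball integrals lies in a compact box. The finite label of f is the centre of a
  -- δ-ball that contains this vector.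
  let G : S → t → ℝ := fun f c => ∫ x in Metric.ball (c : E) r, φ f x ∂μ
  have hG : ∀ f, G f ∈ Metric.closedBall (0 : t → ℝ) C := by
    intro f
    refine mem_closedBall_zero_iff.2 ((pi_norm_le_iff_of_nonneg C.2).2 ?_)
    intro c
    have h1 : ‖G f c‖ₑ ≤ (C : ℝ≥0∞) := (enorm_integral_le_lintegral_enorm _).trans
      ((setLIntegral_le_lintegral _ _).trans (hφC f))
    exact_mod_cast h1
  obtain ⟨T, hT, hTc⟩ := Metric.totallyBounded_iff.1
    (isCompact_closedBall (0 : t → ℝ) C).totallyBounded δ hδpos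
  choose F hFT hF using fun f => Set.mem_iUnion₂.1 (hTc (hG f))
  refine ⟨T, hT.fintype, fun f => ⟨F f, hFT f⟩, fun f g hfg => ?_⟩
  have hfg' : F f = F g := congrArg Subtype.val hfg
  have hdist : dist (G f) (G g) ≤ 2 * δ := by
    have h1 := Metric.mem_ball.1 (hF f)
    have h2 := Metric.mem_ball.1 (hF g)
    rw [← hfg'] at h2
    linarith [dist_triangle_right (G f) (G g) (F f)]
  set w : E → ℝ := fun x => φ f x - φ g x with hw
  have hwD : ∫⁻ x, ‖fderiv ℝ w x‖ₑ ∂μ ≤ ENNReal.ofReal (2 * C) := by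
    calc ∫⁻ x, ‖fderiv ℝ w x‖ₑ ∂μ
        ≤ ∫⁻ x, (‖fderiv ℝ (φ f) x‖ₑ + ‖fderiv ℝ (φ g) x‖ₑ) ∂μ := by
          refine lintegral_mono fun x => ?_
          rw [hw, fderiv_fun_sub ((hφd f).differentiable one_ne_zero x)
            ((hφd g).differentiable one_ne_zero x)]
          exact enorm_sub_le
      _ = ∫⁻ x, ‖fderiv ℝ (φ f) x‖ₑ ∂μ + ∫⁻ x, ‖fderiv ℝ (φ g) x‖ₑ ∂μ :=
          lintegral_add_left
            (((hφd f).continuous_fderiv one_ne_zero).enorm.measurable) _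
      _ ≤ C + C := add_le_add (hφD f) (hφD g)
      _ = _ := by
          rw [two_mul, ENNReal.ofReal_add C.coe_nonneg C.coe_nonneg, ENNReal.ofReal_coe_nnreal]
  have hwM : ∀ c ∈ t, ‖∫ x in Metric.ball c r, w x ∂μ‖ₑ ≤ ENNReal.ofReal (2 * δ) := by
    intro c hc
    rw [integral_sub (hφi f).integrableOn (hφi g).integrableOn, ← ofReal_norm]
    refine ENNReal.ofReal_le_ofReal ?_
    rw [← dist_eq_norm]
    exact (dist_le_pi_dist (G f) (G g) ⟨c, hc⟩).trans hdist
  have key := measure_ball_mul_lintegral_enorm_le μ ((hφd f).sub (hφd g)) hAt hAm hwM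
  have hw1 : ∫⁻ x in A, ‖w x‖ₑ ∂μ ≤ ENNReal.ofReal (ε / 2) := by
    refine (ENNReal.mul_le_mul_iff_right hV0 hVfin).1 (key.trans ?_)
    calc _ ≤ ENNReal.ofReal (2 ^ n) * V * (ENNReal.ofReal (2 * r) * ENNReal.ofReal (2 * C)) +
          ENNReal.ofReal (2 * δ) * ENNReal.ofReal a := by
          rw [Measure.addHaar_ball_mul_of_pos μ 0 two_pos r, ha, ENNReal.ofReal_toReal hAfin]
          gcongr
      _ = V * ENNReal.ofReal (2 ^ n * (2 * r * (2 * C))) + ENNReal.ofReal (2 * δ * a) := by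
          rw [← ENNReal.ofReal_mul (by positivity), ← ENNReal.ofReal_mul (by positivity),
            ENNReal.ofReal_mul (p := 2 ^ n) (by positivity)]
          ring
      _ ≤ V * ENNReal.ofReal (ε / 4) + V * ENNReal.ofReal (ε / 4) := by
          gcongr
          refine (ENNReal.ofReal_le_ofReal hδa).trans_eq ?_
          rw [ENNReal.ofReal_mul hVpos.le, ENNReal.ofReal_toReal hVfin]
      _ = _ := by
          rw [← mul_add, ← ENNReal.ofReal_add (by positivity) (by positivity)]
          congr 2; ring
  have hmeas : ∀ f, AEStronglyMeasurable (φ f) (μ.restrict A) := fun f =>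
    (hφd f).continuous.aestronglyMeasurable
  have hsm : ∀ f : S, AEStronglyMeasurable (f : Lp ℝ 1 (μ.restrict A)) (μ.restrict A) := fun f =>
    Lp.aestronglyMeasurable _
  have hedist : edist (f : Lp ℝ 1 (μ.restrict A)) g < ENNReal.ofReal ε := by
    rw [Lp.edist_def]
    have e : ((f : Lp ℝ 1 (μ.restrict A)) : E → ℝ) - (g : Lp ℝ 1 (μ.restrict A)) =
        ((fun x => (f : Lp ℝ 1 (μ.restrict A)) x - φ f x) + w) -
          fun x => (g : Lp ℝ 1 (μ.restrict A)) x - φ g x := by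
      funext x
      simp only [Pi.sub_apply, Pi.add_apply, hw]
      ring
    rw [e]
    calc _ ≤ eLpNorm (fun x => (f : Lp ℝ 1 (μ.restrict A)) x - φ f x) 1 (μ.restrict A) +
          eLpNorm w 1 (μ.restrict A) +
          eLpNorm (fun x => (g : Lp ℝ 1 (μ.restrict A)) x - φ g x) 1 (μ.restrict A) := by
          refine (eLpNorm_sub_le (((hsm f).sub (hmeas f)).add ((hmeas f).sub (hmeas g)))
            ((hsm g).sub (hmeas g)) le_rfl).trans (add_le_add_left ?_ _)
          exact eLpNorm_add_le ((hsm f).sub (hmeas f)) ((hmeas f).sub (hmeas g)) le_rfl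
      _ ≤ ENNReal.ofReal (ε / 8) + ENNReal.ofReal (ε / 2) + ENNReal.ofReal (ε / 8) := by
          gcongr
          · exact (hφf f).le
          · rw [eLpNorm_one_eq_lintegral_enorm]; exact hw1
          · exact (hφf g).le
      _ < ENNReal.ofReal ε := by
          rw [← ENNReal.ofReal_add (by positivity) (by positivity),
            ← ENNReal.ofReal_add (by positivity) (by positivity)]
          exact (ENNReal.ofReal_lt_ofReal_iff hε).2 (by linarith)
  rw [edist_dist] at hedist
  exact (ENNReal.ofReal_lt_ofReal_iff hε).1 hedist

/-! ### Weak gradients and approximation by test functions -/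

section WeakGradient

variable {d : ℕ} {Ω : Opens (EuclideanSpace ℝ (Fin d))}

/-- The weak gradient of a test function is its classical gradient. -/
theorem HasWeakGradient.ae_norm_eq_fderiv {φ : 𝓓(Ω, ℝ)}
    {g : EuclideanSpace ℝ (Fin d) → EuclideanSpace ℝ (Fin d)} (h : HasWeakGradient Ω φ g) :
    ∀ᵐ x ∂volume.restrict (Ω : Set (EuclideanSpace ℝ (Fin d))), ‖fderiv ℝ φ x‖ₑ = ‖g x‖ₑ := by
  have hφ : ContDiff ℝ 1 φ := φ.contDiff.of_le (by exact_mod_cast le_top)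
  -- Fundamental lemma of the calculus of variations: the weak identity and classical integration by
  -- parts agree on every test function ψ.
  have key : ∀ v : EuclideanSpace ℝ (Fin d), ∀ᵐ x,
      x ∈ (Ω : Set (EuclideanSpace ℝ (Fin d))) → inner ℝ (g x) v - fderiv ℝ φ x v = 0 := by
    intro v
    have hDv : Continuous fun x => fderiv ℝ φ x v :=
      (hφ.continuous_fderiv one_ne_zero).clm_apply continuous_const
    refine Ω.isOpen.ae_eq_zero_of_integral_contDiff_smul_eq_zero
      (LocallyIntegrableOn.sub ?_ (hDv.locallyIntegrable.locallyIntegrableOn _)) ?_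
    · intro x hx
      obtain ⟨s, hs, hi⟩ := h.locallyIntegrableOn_grad x hx
      exact ⟨s, hs, Integrable.inner_const hi v⟩
    · intro ψ hψ hψc hψs
      set Ψ : 𝓓(Ω, ℝ) := ⟨ψ, hψ, hψc, hψs⟩
      have hψ1 : ContDiff ℝ 1 ψ := hψ.of_le (by exact_mod_cast le_top)
      have hDψ : Continuous fun x => fderiv ℝ ψ x v :=
        (hψ1.continuous_fderiv one_ne_zero).clm_apply continuous_const
      have hweak : ∫ x in Ω, φ x * fderiv ℝ ψ x v = - ∫ x in Ω, ψ x * inner ℝ (g x) v :=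
        h.integral_eq Ψ v
      have hparts : ∫ x, φ x * fderiv ℝ ψ x v = - ∫ x, fderiv ℝ φ x v * ψ x := by
        refine integral_mul_fderiv_eq_neg_fderiv_mul_of_integrable ?_ ?_ ?_
          (fun x _ => hφ.differentiable one_ne_zero x)
          (fun x _ => hψ1.differentiable one_ne_zero x)
        · exact (hDv.mul hψ.continuous).integrable_of_hasCompactSupport hψc.mul_left
        · exact (φ.continuous.mul hDψ).integrable_of_hasCompactSupport φ.hasCompactSupport.mul_right
        · exact (φ.continuous.mul hψ.continuous).integrable_of_hasCompactSupport hψc.mul_left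
      have hψ0 : ∀ x, x ∉ (Ω : Set (EuclideanSpace ℝ (Fin d))) → ψ x = 0 := fun x hx =>
        image_eq_zero_of_notMem_tsupport fun h => hx (hψs h)
      have hφ0 : ∀ x, x ∉ (Ω : Set (EuclideanSpace ℝ (Fin d))) → φ x = 0 := fun x hx =>
        image_eq_zero_of_notMem_tsupport fun h => hx (φ.tsupport_subset h)
      have hset : ∀ f : EuclideanSpace ℝ (Fin d) → ℝ,
          (∀ x, x ∉ (Ω : Set (EuclideanSpace ℝ (Fin d))) → f x = 0) →
          ∫ x, f x = ∫ x in Ω, f x := fun f hf =>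
        (setIntegral_eq_integral_of_forall_compl_eq_zero hf).symm
      rw [hset _ fun x hx => by rw [hφ0 x hx, zero_mul],
        hset _ fun x hx => by rw [hψ0 x hx, mul_zero],
        hweak, neg_inj] at hparts
      rw [hset _ fun x hx => by rw [hψ0 x hx, zero_smul]]
      simp only [smul_eq_mul, mul_sub]
      have hi₁ : IntegrableOn (fun x => ψ x * inner ℝ (g x) v) Ω :=
        integrableOn_mul_inner h.locallyIntegrableOn_grad Ψ v
      have hi₂ : IntegrableOn (fun x => ψ x * fderiv ℝ φ x v) Ω :=
        ((hψ.continuous.mul hDv).integrable_of_hasCompactSupport hψc.mul_right).integrableOn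
      rw [integral_sub hi₁ hi₂, hparts]
      simp [mul_comm]
  -- The null set depends on the direction, so only the finitely many basis directions are used;
  -- they determine the derivative.
  have hall := ae_all_iff.2 fun i => key (EuclideanSpace.basisFun (Fin d) ℝ i)
  filter_upwards [ae_restrict_of_ae hall, ae_restrict_mem Ω.isOpen.measurableSet] with x hx hxΩ
  have e : InnerProductSpace.toDual ℝ _ (g x) = fderiv ℝ φ x := by
    refine ContinuousLinearMap.coe_injective
      ((EuclideanSpace.basisFun (Fin d) ℝ).toBasis.ext fun i => ?_)
    have := hx i hxΩ
    simpa [sub_eq_zero] using this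
  rw [← e, ← ofReal_norm, LinearIsometryEquiv.norm_map, ofReal_norm]

/-- A function of `W^{1,q}` norm at most one that is in the closure of the test functions is an
`L¹` limit of test functions with a uniform `W^{1,1}` bound. -/
theorem IsSobolevZero.exists_testFunction
    (hΩ : Bornology.IsBounded (Ω : Set (EuclideanSpace ℝ (Fin d))))
    {q : ℝ≥0∞} (hq : 1 ≤ q) :
    ∃ C : ℝ≥0, ∀ u : EuclideanSpace ℝ (Fin d) → ℝ, IsSobolevZero Ω q u → sobolevENorm Ω q u ≤ 1 →
      ∀ ε : ℝ≥0∞, 0 < ε → ∃ φ : 𝓓(Ω, ℝ),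
        eLpNorm (fun x => u x - φ x) 1 (volume.restrict Ω) < ε ∧ ∫⁻ x, ‖φ x‖ₑ ≤ C ∧
        ∫⁻ x, ‖fderiv ℝ φ x‖ₑ ≤ C := by
  -- Hölder constant |Ω|^(1 - 1/q) from `L^q` to `L¹`. For q = ∞, `toReal` gives 0 and 1/0 = 0,
  -- hence exponent 1.
  set K : ℝ≥0∞ := (volume.restrict (Ω : Set (EuclideanSpace ℝ (Fin d)))) Set.univ ^
    (1 / (1 : ℝ≥0∞).toReal - 1 / q.toReal) with hKdef
  have hK : K ≠ ∞ := by
    refine ENNReal.rpow_ne_top_of_nonneg ?_ ?_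
    · rcases eq_or_ne q ∞ with rfl | hq'
      · simp
      · have : 1 ≤ q.toReal := by simpa using ENNReal.toReal_mono hq' hq
        simpa using inv_le_one_of_one_le₀ this
    · rw [Measure.restrict_apply_univ]
      exact hΩ.measure_lt_top.ne
  refine ⟨(3 * K).toNNReal, fun u hu hu1 ε hε => ?_⟩
  rw [ENNReal.coe_toNNReal (ENNReal.mul_ne_top (by simp) hK)]
  -- The bound 1 keeps the Sobolev norm of φ at most 2; the other bound makes the `L¹` error less
  -- than ε after Hölder.
  obtain ⟨φ, hφ⟩ := hu.2 (min 1 (ε / (K + 1)))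
    (lt_min one_pos (ENNReal.div_pos hε.ne' (by simp [hK])))
  have hφ1 : sobolevENorm Ω q φ < 3 := by
    have e : (φ : EuclideanSpace ℝ (Fin d) → ℝ) = fun x => -1 * (u x - φ x) + u x := by
      funext x; ring
    rw [e]
    calc _ ≤ sobolevENorm Ω q (fun x => -1 * (u x - φ x)) + sobolevENorm Ω q u :=
          sobolevENorm_add_le Ω q hq _ _
      _ ≤ ‖(-1 : ℝ)‖ₑ * sobolevENorm Ω q (fun x => u x - φ x) + 1 := by
          gcongr
          exact sobolevENorm_smul_le Ω q _ _
      _ ≤ 1 + 1 := by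
          gcongr
          simpa using (hφ.trans_le (min_le_left _ _)).le
      _ < 3 := by norm_num
  -- An actual weak gradient is extracted from the infimum by a strict inequality, hence the
  -- constant 3 instead of 2.
  obtain ⟨g, hg, hgn⟩ := by simpa only [sobolevENorm, iInf_lt_iff] using hφ1
  obtain ⟨g', hg', hgn'⟩ := by simpa only [sobolevENorm, iInf_lt_iff] using hφ
  have hint : ∀ {F : Type} [NormedAddCommGroup F] (f : EuclideanSpace ℝ (Fin d) → F),
      AEStronglyMeasurable f (volume.restrict (Ω : Set (EuclideanSpace ℝ (Fin d)))) →
      eLpNorm f 1 (volume.restrict Ω) ≤ eLpNorm f q (volume.restrict Ω) * K := fun f hf =>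
    eLpNorm_le_eLpNorm_mul_rpow_measure_univ hq hf
  refine ⟨φ, ?_, ?_, ?_⟩
  · calc _ ≤ _ := hint _ (hg'.aestronglyMeasurable Ω).1
      _ ≤ eLpNorm (fun x => u x - φ x) q (volume.restrict Ω) * (K + 1) := by
          gcongr; exact le_self_add
      _ < ε := by
          rw [← ENNReal.lt_div_iff_mul_lt (by simp) (by simp [hK])]
          exact (le_self_add.trans_lt hgn').trans_le (min_le_right _ _)
  · calc ∫⁻ x, ‖φ x‖ₑ = eLpNorm φ 1 (volume.restrict Ω) := by
          rw [eLpNorm_one_eq_lintegral_enorm, setLIntegral_eq_of_support_subset]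
          intro x hx
          refine φ.tsupport_subset (subset_tsupport _ ?_)
          intro h0; exact hx (by simp [h0])
      _ ≤ _ := hint _ (hg.aestronglyMeasurable Ω).1
      _ ≤ 3 * K := by gcongr; exact (le_self_add.trans_lt hgn).le
  · calc ∫⁻ x, ‖fderiv ℝ φ x‖ₑ = eLpNorm g 1 (volume.restrict Ω) := by
          rw [eLpNorm_one_eq_lintegral_enorm, ← lintegral_congr_ae hg.ae_norm_eq_fderiv,
            setLIntegral_eq_of_support_subset]
          intro x hx
          refine φ.tsupport_subset (support_fderiv_subset ℝ ?_)
          intro h0; refine hx ?_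
          change ‖fderiv ℝ φ x‖ₑ = 0
          rw [h0, ← ofReal_norm, norm_zero, ENNReal.ofReal_zero]
      _ ≤ _ := hint _ (hg.aestronglyMeasurable Ω).2
      _ ≤ 3 * K := by gcongr; exact (le_add_self.trans_lt hgn).le

end WeakGradient

/-! ### From `L¹` compactness to Orlicz compactness -/

/-- An `L¹` limit is the a.e. limit of a subsequence, which preserves the bound. Thus closing the
unit ball in `L¹` keeps its elements bounded. -/
theorem isClosed_setOf_ae_abs_le {α : Type*} [MeasurableSpace α] (μ : Measure α) (R : ℝ) :
    IsClosed {f : Lp ℝ 1 μ | ∀ᵐ x ∂μ, |f x| ≤ R} := by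
  refine IsSeqClosed.isClosed fun f g hf hg => ?_
  obtain ⟨ns, -, hns⟩ := (tendstoInMeasure_of_tendsto_Lp hg).exists_seq_tendsto_ae
  filter_upwards [hns, ae_all_iff.2 hf] with x hx hfx
  exact le_of_tendsto hx.abs (Filter.Eventually.of_forall fun i => hfx (ns i))

/-- The case k = 1/R of the `L¹` control, with ‖w‖₁ ≤ R μ(univ). Linearity in R is what bounds the
embedding operator. -/
theorem YoungFunction.orliczENorm_le_of_ae_abs_le {α : Type*} [MeasurableSpace α]
    (Φ : YoungFunction) (μ : Measure α) {w : α → ℝ} (hw : AEMeasurable w μ) {R : ℝ}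
    (hR : 0 < R) (hwR : ∀ᵐ x ∂μ, |w x| ≤ R) :
    Φ.orliczENorm μ w ≤ ENNReal.ofReal R * (ENNReal.ofReal (Φ 1) * μ Set.univ + 1) := by
  have h := Φ.ofReal_mul_orliczENorm_le μ hw (inv_pos.2 hR) hR hwR
  have hint : ∫⁻ x, ‖w x‖ₑ ∂μ ≤ ENNReal.ofReal R * μ Set.univ := by
    rw [← lintegral_const]
    refine lintegral_mono_ae ?_
    filter_upwards [hwR] with x hx
    rw [Real.enorm_eq_ofReal_abs]
    exact ENNReal.ofReal_le_ofReal hx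
  have hR' : ENNReal.ofReal R * ENNReal.ofReal R⁻¹ = 1 := by
    rw [← ENNReal.ofReal_mul hR.le, mul_inv_cancel₀ hR.ne', ENNReal.ofReal_one]
  rw [inv_mul_cancel₀ hR.ne'] at h
  calc Φ.orliczENorm μ w
      = ENNReal.ofReal R * (ENNReal.ofReal R⁻¹ * Φ.orliczENorm μ w) := by
        rw [← mul_assoc, hR', one_mul]
    _ ≤ ENNReal.ofReal R *
          (ENNReal.ofReal (Φ 1 / R) * (ENNReal.ofReal R * μ Set.univ) + 1) := by
        gcongr
        exact h.trans (by gcongr)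
    _ = _ := by
        rw [← mul_assoc (ENNReal.ofReal (Φ 1 / R)),
          ← ENNReal.ofReal_mul (div_nonneg (Φ.nonneg 1 zero_le_one) hR.le),
          div_mul_cancel₀ _ hR.ne']

/-- An `L¹`-compact set of uniformly bounded functions is compact in the Orlicz space. -/
theorem YoungFunction.isCompact_orliczSpace {α : Type*} [MeasurableSpace α]
    (Φ : YoungFunction) (μ : Measure α) [IsFiniteMeasure μ] {R : ℝ} (hR : 0 < R)
    {S : Set (Lp ℝ 1 μ)} (hS : IsCompact S) (hSR : ∀ f ∈ S, ∀ᵐ x ∂μ, |f x| ≤ R) :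
    IsCompact {w : Φ.orliczSpace μ | ∃ f ∈ S, (w : α →ₘ[μ] ℝ) = f} := by
  let G : S → Φ.orliczSpace μ := fun f => ⟨f.1.1,
    (Φ.orliczENorm_le_of_ae_abs_le μ (Lp.aestronglyMeasurable f.1).aemeasurable hR
      (hSR f f.2)).trans_lt
      (ENNReal.mul_lt_top ENNReal.ofReal_lt_top (ENNReal.add_lt_top.2
        ⟨ENNReal.mul_lt_top ENNReal.ofReal_lt_top (measure_lt_top μ _), ENNReal.one_lt_top⟩))⟩
  have hG : Continuous G := by
    refine Metric.continuous_iff.2 fun f ε hε => ?_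
    -- Differences are bounded by 2R. With k = 2/ε and `L¹` distance below 1/(B + 1), the right-hand
    -- side is less than 1 + 1 = kε.
    set B := Φ (2 / ε * (2 * R)) / (2 * R) with hB
    have hB0 : 0 ≤ B := div_nonneg (Φ.nonneg _ (by positivity)) (by positivity)
    refine ⟨1 / (B + 1), by positivity, fun g hgf => ?_⟩
    set w : Lp ℝ 1 μ := g.1 - f.1 with hw
    have hwR : ∀ᵐ x ∂μ, |w x| ≤ 2 * R := by
      filter_upwards [Lp.coeFn_sub g.1 f.1, hSR f f.2, hSR g g.2] with x hx hfx hgx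
      rw [hx, Pi.sub_apply, two_mul]
      exact (abs_sub _ _).trans (add_le_add hgx hfx)
    have hnorm : ∫⁻ x, ‖w x‖ₑ ∂μ = ENNReal.ofReal (dist g f) := by
      rw [← eLpNorm_one_eq_lintegral_enorm, ← Lp.enorm_def, ← ofReal_norm, hw, ← dist_eq_norm]
      rfl
    have key := Φ.ofReal_mul_orliczENorm_le μ (Lp.aestronglyMeasurable w).aemeasurable
      (k := 2 / ε) (R := 2 * R) (by positivity) (by positivity) hwR
    rw [hnorm, ← hB, ← ENNReal.ofReal_mul hB0] at key
    have hlt : ENNReal.ofReal (2 / ε) * Φ.orliczENorm μ w <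
        ENNReal.ofReal (2 / ε) * ENNReal.ofReal ε := by
      rw [← ENNReal.ofReal_mul (by positivity), div_mul_cancel₀ _ hε.ne']
      refine key.trans_lt ?_
      have hB1 : B * dist g f < 1 := by
        rw [lt_div_iff₀ (by positivity)] at hgf
        nlinarith [dist_nonneg (x := g) (y := f)]
      calc ENNReal.ofReal (B * dist g f) + 1 < 1 + 1 :=
            ENNReal.add_lt_add_right ENNReal.one_ne_top (ENNReal.ofReal_lt_one.2 hB1)
        _ = ENNReal.ofReal 2 := by norm_num
    have hlt' : Φ.orliczENorm μ w < ENNReal.ofReal ε := lt_of_mul_lt_mul_left' hlt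
    rw [dist_eq_norm]
    exact (ENNReal.lt_ofReal_iff_toReal_lt hlt'.ne_top).1 hlt'
  have := isCompact_iff_compactSpace.1 hS
  convert isCompact_range hG using 1
  ext w
  constructor
  · rintro ⟨f, hf, hwf⟩
    exact ⟨⟨f, hf⟩, Subtype.ext hwf.symm⟩
  · rintro ⟨f, rfl⟩
    exact ⟨f, f.2, rfl⟩

/-! ### The embedding and its compactness -/

section Embedding

variable {d : ℕ} (Ω : Opens (EuclideanSpace ℝ (Fin d))) (q : ℝ≥0∞) [Fact (1 ≤ q)]

/-- The extended norm is finite on the space, so `toReal` loses nothing. -/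
theorem sobolevLinftyENorm_eq_ofReal_norm (u : sobolevZeroLinfty Ω q) :
    sobolevLinftyENorm Ω q
      (u : EuclideanSpace ℝ (Fin d) →ₘ[volume.restrict (Ω : Set (EuclideanSpace ℝ (Fin d)))] ℝ) =
      ENNReal.ofReal ‖u‖ :=
  (ENNReal.ofReal_toReal (max_lt u.2.1.1 u.2.2).ne).symm

theorem ae_abs_le_norm (u : sobolevZeroLinfty Ω q) :
    ∀ᵐ x ∂volume.restrict (Ω : Set (EuclideanSpace ℝ (Fin d))),
      |(u : EuclideanSpace ℝ (Fin d) →ₘ[volume.restrict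
        (Ω : Set (EuclideanSpace ℝ (Fin d)))] ℝ) x| ≤ ‖u‖ := by
  filter_upwards [ae_le_eLpNormEssSup (f := (u : EuclideanSpace ℝ (Fin d) →ₘ[volume.restrict
    (Ω : Set (EuclideanSpace ℝ (Fin d)))] ℝ))] with x hx
  rw [← eLpNorm_exponent_top] at hx
  have h := hx.trans ((le_max_right _ _).trans_eq (sobolevLinftyENorm_eq_ofReal_norm Ω q u))
  rw [Real.enorm_eq_ofReal_abs] at h
  exact (ENNReal.ofReal_le_ofReal_iff (norm_nonneg u)).1 h

/-- The unit ball of `W₀^{1,q} ∩ L^∞` is totally bounded in `L¹`. -/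
theorem totallyBounded_unitBall_L1 (hΩ : Bornology.IsBounded (Ω : Set (EuclideanSpace ℝ (Fin d)))) :
    TotallyBounded {f : Lp ℝ 1 (volume.restrict (Ω : Set (EuclideanSpace ℝ (Fin d)))) |
      ∃ u : sobolevZeroLinfty Ω q, ‖u‖ ≤ 1 ∧
        (u : EuclideanSpace ℝ (Fin d) →ₘ[volume.restrict
          (Ω : Set (EuclideanSpace ℝ (Fin d)))] ℝ) = f} := by
  obtain ⟨C, hC⟩ := IsSobolevZero.exists_testFunction hΩ (q := q) Fact.out
  refine totallyBounded_of_approx_contDiff volume hΩ Ω.isOpen.measurableSet C _ ?_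
  rintro f ⟨u, hu, huf⟩ ε hε
  rw [← huf]
  have hu1 : sobolevENorm Ω q (u : EuclideanSpace ℝ (Fin d) →ₘ[volume.restrict
      (Ω : Set (EuclideanSpace ℝ (Fin d)))] ℝ) ≤ 1 := by
    refine ((le_max_left _ _).trans_eq (sobolevLinftyENorm_eq_ofReal_norm Ω q u)).trans ?_
    exact ENNReal.ofReal_le_one.2 hu
  obtain ⟨φ, h1, h2, h3⟩ := hC _ u.2.1 hu1 ε hε
  exact ⟨φ, φ.contDiff.of_le (by exact_mod_cast le_top), φ.hasCompactSupport, h1, h2, h3⟩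

end Embedding

theorem proposition5p2 {d : ℕ} (Ω : TopologicalSpace.Opens (EuclideanSpace ℝ (Fin d)))
    (hΩ_conn : IsConnected (Ω : Set (EuclideanSpace ℝ (Fin d))))
    (hΩ_bdd : Bornology.IsBounded (Ω : Set (EuclideanSpace ℝ (Fin d))))
    (q : ENNReal) [Fact (1 ≤ q)] (hq : q ≠ ⊤) (Φ : YoungFunction) :
    ∃ ι : sobolevZeroLinfty Ω q →L[ℝ]
        Φ.orliczSpace (MeasureTheory.volume.restrict (Ω : Set (EuclideanSpace ℝ (Fin d)))),
      (∀ u : sobolevZeroLinfty Ω q,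
        (ι u : EuclideanSpace ℝ (Fin d) →ₘ[MeasureTheory.volume.restrict
          (Ω : Set (EuclideanSpace ℝ (Fin d)))] ℝ) = u) ∧
      IsCompactOperator ι := by
  set μ := volume.restrict (Ω : Set (EuclideanSpace ℝ (Fin d))) with hμ
  have hfin : IsFiniteMeasure μ :=
    ⟨by rw [hμ, Measure.restrict_apply_univ]; exact hΩ_bdd.measure_lt_top⟩
  set D : ℝ≥0∞ := ENNReal.ofReal (Φ 1) * μ Set.univ + 1 with hD
  have hDfin : D < ∞ := ENNReal.add_lt_top.2
    ⟨ENNReal.mul_lt_top ENNReal.ofReal_lt_top (measure_lt_top μ _), ENNReal.one_lt_top⟩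
  have hle : ∀ (u : sobolevZeroLinfty Ω q) (R : ℝ), 0 < R → ‖u‖ ≤ R →
      Φ.orliczENorm μ (u : EuclideanSpace ℝ (Fin d) →ₘ[μ] ℝ) ≤ ENNReal.ofReal R * D :=
    fun u R hR huR => Φ.orliczENorm_le_of_ae_abs_le μ (AEEqFun.aemeasurable _) hR
      ((ae_abs_le_norm Ω q u).mono fun x hx => hx.trans huR)
  have hmem : ∀ u : sobolevZeroLinfty Ω q,
      (u : EuclideanSpace ℝ (Fin d) →ₘ[μ] ℝ) ∈ Φ.orliczSpace μ := fun u =>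
    (hle u (‖u‖ + 1) (by positivity) (by linarith)).trans_lt
      (ENNReal.mul_lt_top ENNReal.ofReal_lt_top hDfin)
  let L : sobolevZeroLinfty Ω q →ₗ[ℝ] Φ.orliczSpace μ :=
    (sobolevZeroLinfty Ω q).subtype.codRestrict (Φ.orliczSpace μ) hmem
  have hL : ∀ u, ‖L u‖ ≤ D.toReal * ‖u‖ := by
    intro u
    -- `hle` needs a positive radius, so u = 0 is treated apart.
    rcases eq_or_ne u 0 with rfl | hu
    · simp
    · have h := ENNReal.toReal_mono (ENNReal.mul_lt_top ENNReal.ofReal_lt_top hDfin).ne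
        (hle u ‖u‖ (norm_pos_iff.2 hu) le_rfl)
      rw [ENNReal.toReal_mul, ENNReal.toReal_ofReal (norm_nonneg u), mul_comm] at h
      exact h
  refine ⟨L.mkContinuous D.toReal hL, fun u => rfl, ?_⟩
  have hcl := (totallyBounded_unitBall_L1 Ω q hΩ_bdd).closure.isCompact_of_isClosed
    isClosed_closure
  -- The compact set is the copy in `L_Φ` of the `L¹` closure of the unit ball; its preimage
  -- contains the unit ball, a neighbourhood of 0.
  refine ⟨_, Φ.isCompact_orliczSpace μ one_pos hcl fun f hf => ?_, ?_⟩
  · refine closure_minimal ?_ (isClosed_setOf_ae_abs_le μ 1) hf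
    rintro f ⟨u, hu, huf⟩
    show ∀ᵐ x ∂μ, |f x| ≤ 1
    rw [← huf]
    exact (ae_abs_le_norm Ω q u).mono fun x hx => hx.trans hu
  · filter_upwards [Metric.closedBall_mem_nhds (0 : sobolevZeroLinfty Ω q) one_pos] with u hu
    rw [mem_closedBall_zero_iff] at hu
    have hLp : (u : EuclideanSpace ℝ (Fin d) →ₘ[μ] ℝ) ∈ Lp ℝ 1 μ :=
      Lp.antitone (le_top : (1 : ℝ≥0∞) ≤ ∞) (Lp.mem_Lp_iff_eLpNorm_lt_top.2 u.2.2)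
    exact ⟨⟨_, hLp⟩, subset_closure ⟨u, hu, rfl⟩, rfl⟩
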